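/- Let $\Bbbk$ be an algebraically closed field and let $A$ be a finite-dimensional basic $\Bbbk$-algebra with a complete set $\{e_\lambda\}_{\lambda\in\Lambda}$ of orthogonal primitive idempotents ($\Lambda$ finite, $\sum_{\lambda}e_\lambda=1$; basic means that the left modules $P_\lambda=Ae_\lambda$ are pairwise non-isomorphic). All modules are finitely generated left modules; put $S_\lambda=P_\lambda/\operatorname{rad}P_\lambda$. For a linear order $\preccurlyeq$ on $\Lambda$, the algebra $A$ is called standardly stratified with respect to $\preccurlyeq$ if there are $A$-modules $D_\lambda$ ($\lambda\in\Lambda$) such that (1) the composition factor multiplicity $[D_\lambda:S_\mu]$ is $0$ whenever $\mu\not\preccurlyeq\lambda$, and (2) for every $\lambda\in\Lambda$ there is a short exact sequence $0\to K_\lambda\to P_\lambda\to D_\lambda\to 0$ in which $K_\lambda$ has a finite filtration with factors isomorphic to modules $D_\mu$ with $\mu\succ\lambda$. The standard module ${}_{\preccurlyeq}\Delta_\lambda$ is the largest quotient of $P_\lambda$ all of whose composition factors $S_\mu$ satisfy $\mu\preccurlyeq\lambda$, and $\mathcal{F}({}_{\preccurlyeq}\Delta)$ is the full subcategory of the category of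 finitely generated left $A$-modules whose objects have a finite filtration with factors isomorphic to standard modules ${}_{\preccurlyeq}\Delta_\lambda$. It is closed under cokernels of monomorphisms if for every exact sequence $0\to L\to M\to N\to 0$ with $L,M\in\mathcal{F}({}_{\preccurlyeq}\Delta)$ also $N\in\mathcal{F}({}_{\preccurlyeq}\Delta)$. If $A$ is standardly stratified with respect to two linear orders $\preccurlyeq$ and $\preccurlyeq'$ on $\Lambda$, and both $\mathcal{F}({}_{\preccurlyeq}\Delta)$ and $\mathcal{F}({}_{\preccurlyeq'}\Delta)$ are closed under cokernels of monomorphisms, then $\mathcal{F}({}_{\preccurlyeq}\Delta)=\mathcal{F}({}_{\preccurlyeq'}\Delta)$. -/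

import Mathlib

open CategoryTheory

universe u v w

namespace Stratified

/-- An idempotent is primitive if it is nonzero and is not the sum of two nonzero orthogonal
idempotents. -/
structure IsPrimitiveIdempotent {A : Type u} [Ring A] (e : A) : Prop where
  idem : IsIdempotentElem e
  ne_zero : e ≠ 0
  indecomposable : ∀ f g : A, IsIdempotentElem f → IsIdempotentElem g →
    f * g = 0 → g * f = 0 → e = f + g → f = 0 ∨ g = 0

section Modules

variable {A : Type u} [Ring A] {Λ : Type w}

/-- The left module `A e`. -/
abbrev proj (e : A) : Submodule A A := Submodule.span A {e}

/-- The top `A e / rad (A e)` of `A e`, where the radical of a module is the intersection of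
its maximal submodules. -/
abbrev simpleTop (e : A) : Type u := proj e ⧸ Module.jacobson A (proj e)

/-- The module `S` is isomorphic to a factor of a composition series of `M`
(that is, the multiplicity `[M : S]` is nonzero). -/
def IsCompositionFactor (A : Type u) [Ring A] (S : Type u) [AddCommGroup S] [Module A S]
    (M : Type v) [AddCommGroup M] [Module A M] : Prop :=
  ∃ s : CompositionSeries (Submodule A M), s.head = ⊥ ∧ s.last = ⊤ ∧
    ∃ i : Fin s.length,
      Nonempty ((s i.succ ⧸ (s i.castSucc).submoduleOf (s i.succ)) ≃ₗ[A] S)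

/-- `M` has a finite filtration `0 = F₀ ≤ F₁ ≤ ⋯ ≤ Fₙ = M` each of whose factors is isomorphic
to `D μ` for some `μ` in `T`. -/
def HasFiltration (D : Λ → ModuleCat.{u} A) (T : Set Λ)
    (M : Type v) [AddCommGroup M] [Module A M] : Prop :=
  ∃ (n : ℕ) (F : Fin (n + 1) → Submodule A M), F 0 = ⊥ ∧ F (Fin.last n) = ⊤ ∧
    ∀ i : Fin n, F i.castSucc ≤ F i.succ ∧
      ∃ μ ∈ T, Nonempty ((F i.succ ⧸ (F i.castSucc).submoduleOf (F i.succ)) ≃ₗ[A] D μ)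

/-- `A` is standardly stratified for the linear order `o` on the index set of the idempotents `e`:
there are modules `Δ l` such that
(1) `[Δ l : S m] = 0` unless `m ≼ l`, and
(2) `Δ l` is a quotient of `P l = A (e l)` by a submodule that has a filtration with factors `Δ m`,
`m ≻ l`. -/
def IsStandardlyStratified (e : Λ → A) (o : LinearOrder Λ) : Prop :=
  ∃ Δ : Λ → ModuleCat.{u} A,
    (∀ l m : Λ, ¬ o.le m l → ¬ IsCompositionFactor A (simpleTop (e m)) (Δ l)) ∧
    (∀ l : Λ, ∃ p : proj (e l) →ₗ[A] Δ l, Function.Surjective p ∧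
      HasFiltration Δ {m | o.lt l m} (LinearMap.ker p))

/-- The smallest submodule `N` of `P l = A (e l)` such that all composition factors `S m` of
`P l / N` satisfy `m ≼ l`. -/
def standardKernel (e : Λ → A) (o : LinearOrder Λ) (l : Λ) : Submodule A (proj (e l)) :=
  sInf {N | ∀ m : Λ, IsCompositionFactor A (simpleTop (e m)) (proj (e l) ⧸ N) → o.le m l}

/-- The standard module: the largest quotient of `P l` all of whose composition factors `S m`
satisfy `m ≼ l`. -/
def standardModule (e : Λ → A) (o : LinearOrder Λ) (l : Λ) : ModuleCat.{u} A :=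
  ModuleCat.of A (proj (e l) ⧸ standardKernel e o l)

/-- The full subcategory of the category of finitely generated left `A`-modules whose objects have
a filtration by standard modules. -/
def standardlyFiltered (e : Λ → A) (o : LinearOrder Λ) : ObjectProperty (ModuleCat.{u} A) :=
  fun M => Module.Finite A M ∧ HasFiltration (standardModule e o) Set.univ M

/-- A full subcategory is closed under cokernels of monomorphisms: if `0 → L → M → N → 0` is exact
and `L`, `M` belong to it, then so does `N`. -/
def ClosedUnderCokernelsOfMonos (C : ObjectProperty (ModuleCat.{u} A)) : Prop :=
  ∀ S : ShortComplex (ModuleCat.{u} A), S.ShortExact → C S.X₁ → C S.X₂ → C S.X₃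

end Modules

end Stratified

/-!
Over an Artinian ring `P m = A (e m)` has a unique maximal submodule, so `S m` is a composition
factor of `X` exactly when there is a nonzero homomorphism `P m → X`. This identifies the standard
modules with the modules `D l` of any stratification. For two orders with standard modules `Δ` and
`Δ'`, consider `0 → K l → P l → Δ' l → 0`: the kernel is filtered by modules `Δ' m` with `m ≻' l`.
Going down along `≼'` we may assume that these lie in `F(Δ)`, so `K l` does; `P l` lies in `F(Δ)`
because `A` is stratified for `≼`, and then so does the cokernel `Δ' l`. Thus `F(Δ') ⊆ F(Δ)`, and
equality holds by symmetry.
-/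

namespace Stratified

section Filtrations

variable {A : Type u} [Ring A] {Λ : Type w} {D : Λ → ModuleCat.{u} A} {T : Set Λ}
  {M : Type*} [AddCommGroup M] [Module A M] {N : Type*} [AddCommGroup N] [Module A N]

/-- The relation between consecutive terms `U ≤ V` of a filtration with factors in `D μ`, `μ ∈ T`.
Filtrations become paths of this relation, so that they can be transported and concatenated with
the API of `Relation.ReflTransGen`. -/
def FiltrationStep (D : Λ → ModuleCat.{u} A) (T : Set Λ) (U V : Submodule A M) : Prop :=
  U ≤ V ∧ ∃ μ ∈ T, Nonempty ((V ⧸ U.submoduleOf V) ≃ₗ[A] D μ)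

theorem hasFiltration_iff_reflTransGen :
    HasFiltration D T M ↔ Relation.ReflTransGen (FiltrationStep D T) (⊥ : Submodule A M) ⊤ := by
  constructor
  · rintro ⟨n, F, hbot, htop, hF⟩
    rw [← hbot, ← htop]
    exact Fin.induction .refl (fun i ih => ih.tail (hF i)) (Fin.last n)
  · intro h
    suffices ∃ s : RelSeries {p : Submodule A M × Submodule A M | FiltrationStep D T p.1 p.2},
        s.head = ⊥ ∧ s.last = ⊤ by
      obtain ⟨s, hbot, htop⟩ := this
      exact ⟨s.length, s, hbot, htop, s.step⟩
    generalize (⊤ : Submodule A M) = V at h ⊢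
    induction h with
    | refl => exact ⟨.singleton _ ⊥, rfl, rfl⟩
    | tail _ hstep ih =>
      obtain ⟨s, hbot, rfl⟩ := ih
      exact ⟨s.snoc _ hstep, by simpa only [RelSeries.head_snoc] using hbot, s.last_snoc _ hstep⟩

theorem FiltrationStep.of_surjective {U V : Submodule A M} {U' V' : Submodule A N}
    (h : FiltrationStep D T U V) (hle : U' ≤ V') (g : V' →ₗ[A] V) (hg : Function.Surjective g)
    (hU : ∀ x : V', (g x : M) ∈ U ↔ (x : N) ∈ U') : FiltrationStep D T U' V' := by
  obtain ⟨-, μ, hμ, ⟨i⟩⟩ := h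
  let q := (U.submoduleOf V).mkQ ∘ₗ g
  have hq : Function.Surjective q := (Submodule.mkQ_surjective _).comp hg
  have hker : U'.submoduleOf V' = LinearMap.ker q := by
    rw [LinearMap.ker_comp, Submodule.ker_mkQ]
    ext x
    exact (hU x).symm
  exact ⟨hle, μ, hμ,
    ⟨(Submodule.quotEquivOfEq _ _ hker).trans ((q.quotKerEquivOfSurjective hq).trans i)⟩⟩

theorem FiltrationStep.map {U V : Submodule A M} (h : FiltrationStep D T U V) (f : M →ₗ[A] N)
    (hf : Function.Injective f) : FiltrationStep D T (U.map f) (V.map f) := by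
  let i := Submodule.equivMapOfInjective f hf V
  refine h.of_surjective (Submodule.map_mono h.1) i.symm.toLinearMap i.symm.surjective fun x => ?_
  obtain ⟨y, rfl⟩ := i.surjective x
  simp [i, hf.eq_iff]

theorem FiltrationStep.comap {U V : Submodule A N} (h : FiltrationStep D T U V) (f : M →ₗ[A] N)
    (hf : Function.Surjective f) : FiltrationStep D T (U.comap f) (V.comap f) := by
  refine h.of_surjective (Submodule.comap_mono h.1) (f.restrict fun _ hx => hx) ?_ fun _ => .rfl
  rintro ⟨y, hy⟩
  obtain ⟨x, rfl⟩ := hf y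
  exact ⟨⟨x, hy⟩, rfl⟩

theorem HasFiltration.reflTransGen_bot {U : Submodule A M} (h : HasFiltration D T U) :
    Relation.ReflTransGen (FiltrationStep D T) ⊥ U := by
  have := (hasFiltration_iff_reflTransGen.1 h).lift (Submodule.map U.subtype)
    fun _ _ hstep => hstep.map _ U.injective_subtype
  simpa only [Function.onFun, Submodule.map_bot, Submodule.map_subtype_top] using this

theorem HasFiltration.reflTransGen_ker_top (h : HasFiltration D T N) (f : M →ₗ[A] N)
    (hf : Function.Surjective f) :
    Relation.ReflTransGen (FiltrationStep D T) (LinearMap.ker f) ⊤ :=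
  (hasFiltration_iff_reflTransGen.1 h).lift (Submodule.comap f) fun _ _ hstep => hstep.comap f hf

theorem HasFiltration.of_quotient {U : Submodule A M} (hU : HasFiltration D T U)
    (hQ : HasFiltration D T (M ⧸ U)) : HasFiltration D T M := by
  have := hQ.reflTransGen_ker_top U.mkQ U.mkQ_surjective
  rw [U.ker_mkQ] at this
  exact hasFiltration_iff_reflTransGen.2 (hU.reflTransGen_bot.trans this)

theorem HasFiltration.of_linearEquiv {μ : Λ} (hμ : μ ∈ T) (i : M ≃ₗ[A] D μ) :
    HasFiltration D T M :=
  hasFiltration_iff_reflTransGen.2 <| .single ⟨bot_le, μ, hμ,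
    ⟨(Submodule.quotEquivOfEqBot _ <| by simp [Submodule.submoduleOf]).trans
      (Submodule.topEquiv.trans i)⟩⟩

theorem HasFiltration.refine {D' : Λ → ModuleCat.{u} A} {T' : Set Λ} (h : HasFiltration D T M)
    (hD : ∀ μ ∈ T, HasFiltration D' T' (D μ)) : HasFiltration D' T' M := by
  rw [hasFiltration_iff_reflTransGen] at h ⊢
  refine Relation.reflTransGen_closed (fun U V hstep => ?_) _ _ h
  obtain ⟨hle, μ, hμ, ⟨i⟩⟩ := hstep
  have hV := (hD μ hμ).reflTransGen_ker_top (i.toLinearMap ∘ₗ (U.submoduleOf V).mkQ)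
    (i.surjective.comp (Submodule.mkQ_surjective _))
  rw [LinearEquiv.ker_comp, Submodule.ker_mkQ] at hV
  have := hV.lift (Submodule.map V.subtype) fun _ _ hstep => hstep.map _ V.injective_subtype
  simpa only [Function.onFun, Submodule.submoduleOf, Submodule.map_comap_subtype,
    inf_eq_right.2 hle, Submodule.map_subtype_top] using this

theorem HasFiltration.hom_eq_zero (h : HasFiltration D T M) {X : Type*} [AddCommGroup X]
    [Module A X] (hX : ∀ μ ∈ T, ∀ f : D μ →ₗ[A] X, f = 0) (f : M →ₗ[A] X) : f = 0 := by
  rw [← LinearMap.ker_eq_top, eq_top_iff]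
  rw [hasFiltration_iff_reflTransGen] at h
  generalize (⊤ : Submodule A M) = W at h ⊢
  induction h with
  | refl => exact bot_le
  | @tail U V _ hstep ih =>
    obtain ⟨-, μ, hμ, ⟨i⟩⟩ := hstep
    let g : (V ⧸ U.submoduleOf V) →ₗ[A] X :=
      (U.submoduleOf V).liftQ (f ∘ₗ V.subtype) fun x hx => ih hx
    have hg : g = 0 := by
      rw [← LinearMap.cancel_right i.symm.surjective, LinearMap.zero_comp]
      exact hX μ hμ _
    intro x hx
    exact LinearMap.congr_fun hg ((U.submoduleOf V).mkQ ⟨x, hx⟩)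

end Filtrations

section Indecomposable

/-- A nonzero module that is not the direct sum of two nonzero submodules. -/
structure IsIndecomposable (A : Type*) [Ring A] (P : Type*) [AddCommGroup P] [Module A P] :
    Prop where
  nontrivial : Nontrivial P
  eq_bot_or_eq_bot : ∀ {U V : Submodule A P}, IsCompl U V → U = ⊥ ∨ V = ⊥

variable {A : Type*} [Ring A] {P : Type*} [AddCommGroup P] [Module A P] [IsNoetherian A P]
  [IsArtinian A P]

theorem IsIndecomposable.isNilpotent_or_bijective (hP : IsIndecomposable A P)
    (φ : Module.End A P) : IsNilpotent φ ∨ Function.Bijective φ := by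
  obtain ⟨n, hn⟩ := Filter.eventually_atTop.1 φ.eventually_isCompl_ker_pow_range_pow
  rcases hP.eq_bot_or_eq_bot (hn (n + 1) n.le_succ) with hker | hrange
  · have hinj : Function.Injective (⇑(φ ^ n) ∘ φ) := by
      rw [← Module.End.coe_mul, ← pow_succ]
      exact LinearMap.ker_eq_bot.1 hker
    exact .inr (IsArtinian.bijective_of_injective_endomorphism φ (.of_comp hinj))
  · exact .inl ⟨n + 1, LinearMap.range_eq_bot.1 hrange⟩

/-- If `M ≠ N` then `P = M + N`, and the projection `P → P ⧸ M` lifts through `N` to an endomorphism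
of `P` that is neither nilpotent nor surjective. -/
theorem IsIndecomposable.eq_of_isCoatom [Module.Projective A P] (hP : IsIndecomposable A P)
    {M N : Submodule A P} (hM : IsCoatom M) (hN : IsCoatom N) : M = N := by
  by_contra hne
  have hsup : M ⊔ N = ⊤ := hM.sup_eq_top_of_ne hN hne
  have hsurj : Function.Surjective (M.mkQ ∘ₗ N.subtype) := by
    rw [← LinearMap.range_eq_top, LinearMap.range_comp, N.range_subtype, M.map_mkQ_eq_top, hsup]
  obtain ⟨g, hg⟩ := Module.projective_lifting_property _ M.mkQ hsurj
  let φ : Module.End A P := N.subtype ∘ₗ g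
  have hpow (n : ℕ) : M.mkQ ∘ₗ (φ ^ n) = M.mkQ := by
    induction n with
    | zero => rfl
    | succ n ih => rw [pow_succ, Module.End.mul_eq_comp, ← LinearMap.comp_assoc, ih]; exact hg
  rcases hP.isNilpotent_or_bijective φ with ⟨n, hn⟩ | hbij
  · refine hM.1 ?_
    rw [← M.ker_mkQ, ← hpow n, hn, LinearMap.comp_zero, LinearMap.ker_zero]
  · refine hN.1 (eq_top_iff.2 fun x _ => ?_)
    obtain ⟨y, rfl⟩ := hbij.surjective x
    exact (g y).2

theorem IsIndecomposable.eq_jacobson_of_isCoatom [Module.Projective A P]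
    (hP : IsIndecomposable A P) {M : Submodule A P} (hM : IsCoatom M) :
    M = Module.jacobson A P :=
  le_antisymm (le_sInf fun _ hN => (hP.eq_of_isCoatom hM hN).le) (sInf_le hM)

theorem IsIndecomposable.nonempty_linearEquiv_of_ne_zero [Module.Projective A P]
    (hP : IsIndecomposable A P) {S : Type*} [AddCommGroup S] [Module A S] [IsSimpleModule A S]
    {f : P →ₗ[A] S} (hf : f ≠ 0) : Nonempty (S ≃ₗ[A] P ⧸ Module.jacobson A P) := by
  have hsurj : Function.Surjective f := LinearMap.surjective_of_ne_zero hf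
  have hker := hP.eq_jacobson_of_isCoatom (LinearMap.isCoatom_ker_of_surjective hsurj)
  exact ⟨(f.quotKerEquivOfSurjective hsurj).symm.trans (Submodule.quotEquivOfEq _ _ hker)⟩

end Indecomposable

section CompositionFactors

theorem exists_le_succ_not_le_castSucc {α : Type*} [LE α] {r : SetRel α α} (s : RelSeries r)
    {a : α} (hhead : ¬ a ≤ s.head) (hlast : a ≤ s.last) :
    ∃ i : Fin s.length, a ≤ s i.succ ∧ ¬ a ≤ s i.castSucc := by
  by_contra! h
  exact Fin.induction (motive := fun i => ¬ a ≤ s i) hhead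
    (fun i hi hsucc => hi (h i hsucc)) (Fin.last _) hlast

variable {A : Type u} [Ring A] {P S : Type u} [AddCommGroup P] [Module A P]
  [Module.Projective A P] [AddCommGroup S] [Module A S]
  {X : Type v} [AddCommGroup X] [Module A X]

theorem IsCompositionFactor.exists_hom_ne_zero [Nontrivial S] (h : IsCompositionFactor A S X)
    {q : P →ₗ[A] S} (hq : Function.Surjective q) : ∃ f : P →ₗ[A] X, f ≠ 0 := by
  obtain ⟨s, -, -, i, ⟨j⟩⟩ := h
  obtain ⟨g, hg⟩ := Module.projective_lifting_property
    (j.toLinearMap ∘ₗ ((s i.castSucc).submoduleOf (s i.succ)).mkQ) q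
    (j.surjective.comp (Submodule.mkQ_surjective _))
  refine ⟨(s i.succ).subtype ∘ₗ g, fun hzero => ?_⟩
  have hg_zero : g = 0 := LinearMap.ext fun x => Subtype.ext (LinearMap.congr_fun hzero x)
  obtain ⟨y, hy⟩ := exists_ne (0 : S)
  obtain ⟨x, rfl⟩ := hq y
  exact hy (by rw [← hg, hg_zero, LinearMap.comp_zero, LinearMap.zero_apply])

/-- The first term of a composition series of `X` that contains the image of `P` yields a nonzero
homomorphism from `P` to a simple factor. -/
theorem IsIndecomposable.isCompositionFactor_of_hom_ne_zero [IsNoetherian A P] [IsArtinian A P]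
    (hP : IsIndecomposable A P) [IsNoetherian A X] [IsArtinian A X] {f : P →ₗ[A] X} (hf : f ≠ 0) :
    IsCompositionFactor A (P ⧸ Module.jacobson A P) X := by
  obtain ⟨s, hbot, htop⟩ := exists_compositionSeries_of_isNoetherian_isArtinian A X
  obtain ⟨i, hle, hnle⟩ := exists_le_succ_not_le_castSucc s (a := LinearMap.range f)
    (by rwa [hbot, le_bot_iff, LinearMap.range_eq_bot]) (htop ▸ le_top)
  have : IsSimpleModule A (s i.succ ⧸ (s i.castSucc).submoduleOf (s i.succ)) :=
    (covBy_iff_quot_is_simple (s.step i).le).1 (s.step i)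
  let g : P →ₗ[A] s i.succ := f.codRestrict (s i.succ) fun x => hle ⟨x, rfl⟩
  have hg : ((s i.castSucc).submoduleOf (s i.succ)).mkQ ∘ₗ g ≠ 0 := fun hzero => hnle <| by
    rintro _ ⟨x, rfl⟩
    exact (Submodule.Quotient.mk_eq_zero (p := (s i.castSucc).submoduleOf (s i.succ))).1
      (LinearMap.congr_fun hzero x)
  exact ⟨s, hbot, htop, i, hP.nonempty_linearEquiv_of_ne_zero hg⟩

theorem IsIndecomposable.isCompositionFactor_iff [IsNoetherian A P] [IsArtinian A P]
    (hP : IsIndecomposable A P) [IsNoetherian A X] [IsArtinian A X] :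
    IsCompositionFactor A (P ⧸ Module.jacobson A P) X ↔ ∃ f : P →ₗ[A] X, f ≠ 0 := by
  have := hP.nontrivial
  have : Nontrivial (P ⧸ Module.jacobson A P) :=
    Submodule.Quotient.nontrivial_iff.2 (Module.jacobson_lt_top A P).ne
  exact ⟨fun h => h.exists_hom_ne_zero (Submodule.mkQ_surjective _),
    fun ⟨_, hf⟩ => hP.isCompositionFactor_of_hom_ne_zero hf⟩

end CompositionFactors

section Idempotents

variable {A : Type u} [Ring A] {e : A}

/-- The idempotent `e` as an element of `P = A e`; a homomorphism from `P` is determined by its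
value there. -/
def projGenerator (e : A) : proj e :=
  ⟨e, Submodule.mem_span_singleton_self e⟩

theorem coe_smul_projGenerator (he : IsIdempotentElem e) (x : proj e) :
    (x : A) • projGenerator e = x := by
  obtain ⟨a, ha⟩ := Submodule.mem_span_singleton.1 x.2
  refine Subtype.ext ?_
  change (x : A) * e = x
  rw [← ha, smul_eq_mul, mul_assoc, he.eq]

theorem projective_proj (he : IsIdempotentElem e) : Module.Projective A (proj e) :=
  .of_split (proj e).subtype (LinearMap.toSpanSingleton A _ (projGenerator e))
    (LinearMap.ext (coe_smul_projGenerator he))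

theorem hom_ext_projGenerator (he : IsIdempotentElem e) {X : Type*} [AddCommGroup X] [Module A X]
    {f g : proj e →ₗ[A] X} (h : f (projGenerator e) = g (projGenerator e)) : f = g := by
  ext x
  rw [← coe_smul_projGenerator he x, map_smul, map_smul, h]

theorem apply_projGenerator_mul_apply_projGenerator (he : IsIdempotentElem e)
    (φ ψ : Module.End A (proj e)) :
    (φ (projGenerator e) : A) * ψ (projGenerator e) = (ψ * φ) (projGenerator e) := by
  rw [Module.End.mul_apply, ← smul_eq_mul, ← Submodule.coe_smul, ← map_smul,
    coe_smul_projGenerator he]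

theorem IsPrimitiveIdempotent.end_eq_zero_or_eq_one (he : IsPrimitiveIdempotent e)
    {φ : Module.End A (proj e)} (hφ : IsIdempotentElem φ) : φ = 0 ∨ φ = 1 := by
  have hmul := apply_projGenerator_mul_apply_projGenerator he.idem
  have zero_of_apply {ψ : Module.End A (proj e)} (h : (ψ (projGenerator e) : A) = 0) : ψ = 0 :=
    hom_ext_projGenerator he.idem (Subtype.ext h)
  rcases he.indecomposable (φ (projGenerator e)) ((1 - φ) (projGenerator e))
    (by rw [IsIdempotentElem, hmul, hφ.eq]) (by rw [IsIdempotentElem, hmul, hφ.one_sub.eq])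
    (by rw [hmul, hφ.one_sub_mul_self]; rfl) (by rw [hmul, hφ.mul_one_sub_self]; rfl)
    (by simp [projGenerator]) with h | h
  · exact .inl (zero_of_apply h)
  · exact .inr (sub_eq_zero.1 (zero_of_apply h)).symm

theorem IsPrimitiveIdempotent.isIndecomposable_proj (he : IsPrimitiveIdempotent e) :
    IsIndecomposable A (proj e) where
  nontrivial := Submodule.nontrivial_iff_ne_bot.2 fun h =>
    he.ne_zero (Submodule.span_singleton_eq_bot.1 h)
  eq_bot_or_eq_bot {U V} h := by
    rcases he.end_eq_zero_or_eq_one (Submodule.isIdempotentElem_projection h) with hzero | hone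
    · exact .inl (by rw [← Submodule.range_projection h, hzero, LinearMap.range_zero])
    · exact .inr (by rw [← Submodule.ker_projection h, hone]; exact LinearMap.ker_id)

end Idempotents

section Standard

variable {A : Type u} [Ring A] {Λ : Type w} {e : Λ → A} {o o' : LinearOrder Λ}

theorem ClosedUnderCokernelsOfMonos.quotient {C : ObjectProperty (ModuleCat.{u} A)}
    (hC : ClosedUnderCokernelsOfMonos C) {M : Type u} [AddCommGroup M] [Module A M]
    {N : Submodule A M} (hN : C (.of A N)) (hM : C (.of A M)) : C (.of A (M ⧸ N)) := by
  let S : ShortComplex (ModuleCat.{u} A) :=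
    .mk (ModuleCat.ofHom N.subtype) (ModuleCat.ofHom N.mkQ) (by ext; simp)
  have hS : S.ShortExact := ModuleCat.shortComplex_shortExact S
    (LinearMap.exact_subtype_mkQ N) N.injective_subtype N.mkQ_surjective
  exact hC S hS hN hM

theorem standardlyFiltered_standardModule (l : Λ) :
    standardlyFiltered e o (standardModule e o l) :=
  ⟨inferInstanceAs (Module.Finite A (proj (e l) ⧸ standardKernel e o l)),
    .of_linearEquiv (Set.mem_univ l) (.refl A _)⟩

variable [IsArtinianRing A]

theorem forall_isCompositionFactor_le_iff (hprim : ∀ l, IsPrimitiveIdempotent (e l)) {l : Λ}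
    {X : Type v} [AddCommGroup X] [Module A X] [Module.Finite A X] :
    (∀ m, IsCompositionFactor A (simpleTop (e m)) X → o.le m l) ↔
      ∀ m, o.lt l m → ∀ f : proj (e m) →ₗ[A] X, f = 0 := by
  refine forall_congr' fun m => ?_
  have := projective_proj (hprim m).idem
  rw [(hprim m).isIndecomposable_proj.isCompositionFactor_iff, ← not_imp_not, not_le]
  simp only [not_exists, not_not]

theorem standardKernel_le_ker (hprim : ∀ l, IsPrimitiveIdempotent (e l)) {l : Λ}
    {X : Type v} [AddCommGroup X] [Module A X]
    (hX : ∀ m, o.lt l m → ∀ f : proj (e m) →ₗ[A] X, f = 0) (p : proj (e l) →ₗ[A] X) :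
    standardKernel e o l ≤ LinearMap.ker p := by
  refine sInf_le ((forall_isCompositionFactor_le_iff hprim).2 fun m hm f => ?_)
  let i := (LinearMap.ker p).liftQ p le_rfl
  have hi : Function.Injective i := LinearMap.ker_eq_bot.1 (Submodule.ker_liftQ_eq_bot' _ p rfl)
  rw [← LinearMap.cancel_left hi, LinearMap.comp_zero]
  exact hX m hm _

theorem HasFiltration.le_standardKernel (hprim : ∀ l, IsPrimitiveIdempotent (e l))
    {D : Λ → ModuleCat.{u} A}
    {p : ∀ m, proj (e m) →ₗ[A] D m} (hp : ∀ m, Function.Surjective (p m)) {l : Λ}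
    {K : Submodule A (proj (e l))} (hK : HasFiltration D {m | o.lt l m} K) :
    K ≤ standardKernel e o l := by
  refine le_sInf fun N hN => ?_
  have hzero : N.mkQ ∘ₗ K.subtype = 0 := hK.hom_eq_zero (fun m hm f => by
    rw [← LinearMap.cancel_right (hp m), LinearMap.zero_comp]
    exact (forall_isCompositionFactor_le_iff hprim).1 hN m hm _) _
  exact fun x hx => (Submodule.Quotient.mk_eq_zero N).1 (LinearMap.congr_fun hzero ⟨x, hx⟩)

theorem IsStandardlyStratified.hasFiltration_standardKernel
    (hprim : ∀ l, IsPrimitiveIdempotent (e l)) (hs : IsStandardlyStratified e o) (l : Λ) :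
    HasFiltration (standardModule e o) {m | o.lt l m} (standardKernel e o l) := by
  obtain ⟨D, hD, hex⟩ := hs
  choose p hp hfil using hex
  have hker (m : Λ) : standardKernel e o m = LinearMap.ker (p m) := by
    have : Module.Finite A (D m) := .of_surjective (p m) (hp m)
    refine le_antisymm (standardKernel_le_ker hprim ?_ (p m)) ((hfil m).le_standardKernel hprim hp)
    exact (forall_isCompositionFactor_le_iff hprim).1 fun n => not_imp_not.1 (hD m n)
  have standardEquiv (m : Λ) : standardModule e o m ≃ₗ[A] D m :=
    (Submodule.quotEquivOfEq _ _ (hker m)).trans ((p m).quotKerEquivOfSurjective (hp m))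
  rw [hker l]
  exact (hfil l).refine fun m hm => .of_linearEquiv hm (standardEquiv m).symm

theorem IsStandardlyStratified.standardlyFiltered_proj
    (hprim : ∀ l, IsPrimitiveIdempotent (e l)) (hs : IsStandardlyStratified e o) (l : Λ) :
    standardlyFiltered e o (.of A (proj (e l))) := by
  refine ⟨inferInstanceAs (Module.Finite A (proj (e l))), .of_quotient ?_
    (standardlyFiltered_standardModule l).2⟩
  exact (hs.hasFiltration_standardKernel hprim l).refine fun m _ =>
    (standardlyFiltered_standardModule m).2

theorem IsStandardlyStratified.standardlyFiltered_standardModule_of_closed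
    (hprim : ∀ l, IsPrimitiveIdempotent (e l)) (hs : IsStandardlyStratified e o)
    (hs' : IsStandardlyStratified e o') (hwf : WellFounded fun l m => o'.lt m l)
    (hc : ClosedUnderCokernelsOfMonos (standardlyFiltered e o)) (l : Λ) :
    standardlyFiltered e o (standardModule e o' l) := by
  induction l using hwf.induction with
  | h l ih =>
    have hK : standardlyFiltered e o (.of A (standardKernel e o' l)) :=
      ⟨inferInstanceAs (Module.Finite A (standardKernel e o' l)),
        (hs'.hasFiltration_standardKernel hprim l).refine fun m hm => (ih m hm).2⟩
    exact hc.quotient hK (hs.standardlyFiltered_proj hprim l)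

theorem IsStandardlyStratified.standardlyFiltered_le
    (hprim : ∀ l, IsPrimitiveIdempotent (e l)) (hs : IsStandardlyStratified e o)
    (hs' : IsStandardlyStratified e o') (hwf : WellFounded fun l m => o'.lt m l)
    (hc : ClosedUnderCokernelsOfMonos (standardlyFiltered e o)) :
    standardlyFiltered e o' ≤ standardlyFiltered e o := fun _ hM =>
  ⟨hM.1, hM.2.refine fun m _ =>
    (hs.standardlyFiltered_standardModule_of_closed hprim hs' hwf hc m).2⟩

end Standard

end Stratified

theorem corollary3p4_general {A : Type u} [Ring A] [IsArtinianRing A] {Λ : Type w} [Finite Λ]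
    {e : Λ → A} (hprim : ∀ l, Stratified.IsPrimitiveIdempotent (e l)) {o o' : LinearOrder Λ}
    (hs : Stratified.IsStandardlyStratified e o)
    (hs' : Stratified.IsStandardlyStratified e o')
    (hc : Stratified.ClosedUnderCokernelsOfMonos (Stratified.standardlyFiltered e o))
    (hc' : Stratified.ClosedUnderCokernelsOfMonos (Stratified.standardlyFiltered e o')) :
    Stratified.standardlyFiltered e o = Stratified.standardlyFiltered e o' := by
  have wellFounded_gt (o : LinearOrder Λ) : WellFounded fun l m => o.lt m l :=
    (Finite.to_wellFoundedGT (α := Λ)).wf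
  exact le_antisymm (hs'.standardlyFiltered_le hprim hs (wellFounded_gt o) hc')
    (hs.standardlyFiltered_le hprim hs' (wellFounded_gt o') hc)

theorem corollary3p4 {k : Type v} [Field k] [IsAlgClosed k]
    {A : Type u} [Ring A] [Algebra k A] [FiniteDimensional k A]
    {Λ : Type w} [Fintype Λ] (e : Λ → A)
    (he : CompleteOrthogonalIdempotents e)
    (hprim : ∀ l, Stratified.IsPrimitiveIdempotent (e l))
    -- the algebra is basic
    (hbasic : ∀ l m, Nonempty (Stratified.proj (e l) ≃ₗ[A] Stratified.proj (e m)) → l = m)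
    (o o' : LinearOrder Λ)
    (hs : Stratified.IsStandardlyStratified e o)
    (hs' : Stratified.IsStandardlyStratified e o')
    (hc : Stratified.ClosedUnderCokernelsOfMonos (Stratified.standardlyFiltered e o))
    (hc' : Stratified.ClosedUnderCokernelsOfMonos (Stratified.standardlyFiltered e o')) :
    Stratified.standardlyFiltered e o = Stratified.standardlyFiltered e o' := by
  have : IsArtinianRing A := isArtinian_of_tower k inferInstance
  exact corollary3p4_general hprim hs hs' hc hc'
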